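/- Let $N\ge 1$, $n\ge 0$, and let $f_1,\dots,f_N:\mathbb{R}^n\to\mathbb{R}$ be twice continuously differentiable, strictly convex functions such that $\sum_{i=1}^N f_i$ attains its minimum on $\mathbb{R}^n$. Let $\mathcal{G}$ be a connected undirected simple graph with vertices $1,\dots,N$ and $M$ edges, each given an arbitrary orientation, and let $D\in\mathbb{R}^{N\times M}$ be its incidence matrix: $D_{ik}=1$ if edge $k$ points to $i$, $D_{ik}=-1$ if edge $k$ originates at $i$, and $D_{ik}=0$ otherwise. Put $\mathbf{D}=I_n\otimes D$. For $x_1,\dots,x_N\in\mathbb{R}^n$ let $z=(z_1,\dots,z_n)\in\mathbb{R}^{Nn}$ with $z_j=(x_{1j},\dots,x_{Nj})$, where $x_{ij}$ is the $j$-th coordinate of $x_i$, and put $f(z)=\sum_{i=1}^N f_i(x_i)$. Let $k_G,k_I'>0$, and for $\mu\in\mathbb{R}^{Mn}$ let $F(z,\mu)=k_G f(z)+k_I' z^{T}\mathbf{D}\mu$. Consider the dynamics $$\dot z=-\frac{\partial F}{\partial z}^{T}=-k_G\nabla f(z)-k_I'\mathbf{D}\mu,\qquad \dot\mu=\frac{\partial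 F}{\partial\mu}^{T}=k_I'\mathbf{D}^{T}z .$$ Then the equilibrium $(\dot z,\dot\mu)=(0,0)$ is globally asymptotically stable, in the following sense. 1. There is at least one equilibrium (a point $(z,\mu)$ at which $\dot z=0$ and $\dot\mu=0$), and the equilibria are exactly the saddle points of $F$, i.e. the points $(z^*,\mu^*)$ with $F(z^*,\mu)\le F(z^*,\mu^*)\le F(z,\mu^*)$ for all $z,\mu$. 2. For every initial value $(z(0),\mu(0))$ the dynamics have exactly one solution on $[0,\infty)$. 3. For every $\varepsilon>0$ there is $\delta>0$ such that every solution on $[0,\infty)$ with $\|(\dot z(0),\dot\mu(0))\|<\delta$ satisfies $\|(\dot z(t),\dot\mu(t))\|<\varepsilon$ for all $t\ge 0$; and $(\dot z(t),\dot\mu(t))\to(0,0)$ as $t\to\infty$ along every solution. 4. Every equilibrium $(z^*,\mu^*)$ is Lyapunov stable (for every $\varepsilon>0$ there is $\delta>0$ such that every solution that starts within $\delta$ of $(z^*,\mu^*)$ stays within $\varepsilon$ of it for all $t\ge 0$), and every solution converges, as $t\to\infty$, to an equilibrium. -/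

import Mathlib

open scoped Matrix Kronecker Gradient

noncomputable section

namespace DualDecomposition

/-- A numbering of the edges of the undirected graph `G` by `Fin M`, each edge listed exactly once
and given an arbitrary orientation: edge `k` originates at `tail k` and points to `head k`. -/
structure OrientedEdges {N : ℕ} (G : SimpleGraph (Fin N)) (M : ℕ) where
  tail : Fin M → Fin N
  head : Fin M → Fin N
  injective : Function.Injective fun k => s(tail k, head k)
  range_eq : Set.range (fun k => s(tail k, head k)) = G.edgeSet

/-- The incidence matrix `D ∈ ℝ^{N × M}`. -/
def incidence {N M : ℕ} {G : SimpleGraph (Fin N)} (o : OrientedEdges G M) :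
    Matrix (Fin N) (Fin M) ℝ :=
  Matrix.of fun i k => if o.head k = i then 1 else if o.tail k = i then -1 else 0

/-- The aggregate incidence matrix `𝐃 = I_n ⊗ D`. -/
def aggIncidence (n : ℕ) {N M : ℕ} {G : SimpleGraph (Fin N)} (o : OrientedEdges G M) :
    Matrix (Fin n × Fin N) (Fin n × Fin M) ℝ :=
  (1 : Matrix (Fin n) (Fin n) ℝ) ⊗ₖ incidence o

/-- The aggregate state space `ℝ^{Nn}`: the entry `z (j, i)` is the `j`-th element `x_{ij}` of the
vector `x_i` of agent `i`. -/
abbrev Primal (n N : ℕ) : Type := EuclideanSpace ℝ (Fin n × Fin N)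

/-- The space `ℝ^{Mn}` of aggregate Lagrange multipliers. -/
abbrev Dual (n M : ℕ) : Type := EuclideanSpace ℝ (Fin n × Fin M)

/-- The vector `x_i ∈ ℝ^n` that agent `i` maintains. -/
def agent {n N : ℕ} (z : Primal n N) (i : Fin N) : EuclideanSpace ℝ (Fin n) :=
  WithLp.toLp 2 fun j => z (j, i)

/-- The aggregate cost `f(z) = ∑ᵢ fᵢ(xᵢ)`. -/
def aggCost {n N : ℕ} (f : Fin N → EuclideanSpace ℝ (Fin n) → ℝ) (z : Primal n N) : ℝ :=
  ∑ i, f i (agent z i)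

/-- The Lagrangian `F(z, μ) = k_G f(z) + k_I' zᵀ 𝐃 μ`. -/
def lagrangian {n N M : ℕ} {G : SimpleGraph (Fin N)} (o : OrientedEdges G M)
    (f : Fin N → EuclideanSpace ℝ (Fin n) → ℝ) (kG kI : ℝ) (z : Primal n N) (μ : Dual n M) : ℝ :=
  kG * aggCost f z + kI * (z.ofLp ⬝ᵥ (aggIncidence n o *ᵥ μ.ofLp))

/-- `(z, μ)` is a saddle point of `max_μ min_z F(z, μ)`. -/
def IsSaddlePoint {E F : Type*} (L : E → F → ℝ) (p : E × F) : Prop :=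
  (∀ μ, L p.1 μ ≤ L p.1 p.2) ∧ ∀ z, L p.1 p.2 ≤ L z p.2

/-- The right-hand side of the dynamics
`ż = -k_G ∇f(z) - k_I' 𝐃 μ`, `μ̇ = k_I' 𝐃ᵀ z`. -/
def dualDynamics {n N M : ℕ} {G : SimpleGraph (Fin N)} (o : OrientedEdges G M)
    (f : Fin N → EuclideanSpace ℝ (Fin n) → ℝ) (kG kI : ℝ) (p : Primal n N × Dual n M) :
    Primal n N × Dual n M :=
  (-(kG • ∇ (aggCost f) p.1) - kI • WithLp.toLp 2 (aggIncidence n o *ᵥ p.2.ofLp),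
    kI • WithLp.toLp 2 ((aggIncidence n o)ᵀ *ᵥ p.1.ofLp))

section Stability

variable {S : Type*} [NormedAddCommGroup S] [NormedSpace ℝ S]

/-- `p` solves `ṗ = X(p)` on `[0, ∞)` (with the one-sided derivative at `0`). -/
def IsSolution (X : S → S) (p : ℝ → S) : Prop :=
  ∀ t, 0 ≤ t → HasDerivWithinAt p (X (p t)) (Set.Ici 0) t

/-- Every initial value is the start of one and only one solution on `[0, ∞)`. -/
def WellPosed (X : S → S) : Prop :=
  ∀ p₀, ∃ p, IsSolution X p ∧ p 0 = p₀ ∧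
    ∀ q, IsSolution X q → q 0 = p₀ → Set.EqOn q p (Set.Ici 0)

/-- The equilibrium `ṗ = 0` is globally asymptotically stable in the coordinates `ṗ = X(p)`:
it is Lyapunov stable, and `ṗ(t) → 0` along every solution. -/
def VelocityGAS (X : S → S) : Prop :=
  (∀ ε > 0, ∃ δ > 0, ∀ p, IsSolution X p → ‖X (p 0)‖ < δ → ∀ t, 0 ≤ t → ‖X (p t)‖ < ε) ∧
    ∀ p, IsSolution X p → Filter.Tendsto (fun t => X (p t)) Filter.atTop (nhds 0)

/-- Global asymptotic stability in the state space, where the equilibrium need not be unique: every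
equilibrium is Lyapunov stable, and every solution converges to an equilibrium. If there is exactly
one equilibrium, this is its global asymptotic stability in the usual sense. -/
def EquilibriaGAS (X : S → S) : Prop :=
  (∀ e, X e = 0 → ∀ ε > 0, ∃ δ > 0, ∀ p, IsSolution X p → ‖p 0 - e‖ < δ →
      ∀ t, 0 ≤ t → ‖p t - e‖ < ε) ∧
    ∀ p, IsSolution X p → ∃ e, X e = 0 ∧ Filter.Tendsto p Filter.atTop (nhds e)

end Stability

end DualDecomposition

end

/-!
The dynamics are the saddle flow of `φ z + ⟪z, A μ⟫` with `φ = k_G f` strictly convex and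
`A = k_I' 𝐃` linear. On the Hilbert sum of the primal and dual spaces its vector field `X` is
monotone: the coupling terms `-A μ` and `A† z` are skew-adjoint, so `⟪p - q, X p - X q⟫` reduces to
`-⟪z_p - z_q, ∇ φ z_p - ∇ φ z_q⟫ ≤ 0`. Hence the distance between any two solutions does not
increase. Contraction gives uniqueness, the Lyapunov stability of every equilibrium, and, when a
solution is compared with its own time shifts, the fact that the speed `‖X (p t)‖` does not increase
(`IsMonotoneField.norm_velocity_le`); no Hessian is needed. It also confines a solution to a ball
around an equilibrium, so that cutting `X` off outside the ball yields solutions for all time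
(`IsMonotoneField.wellPosed`).

Convergence is LaSalle's principle (`IsMonotoneField.exists_tendsto`). A limit point of a solution
starts a solution at constant distance from an equilibrium `e`. By strict monotonicity of `∇ φ` its
primal part is that of `e`, so both velocities vanish and the limit point is itself an equilibrium
(`hilbertSaddleFlow_eq_zero_of_inner_eq_zero`); the distance to it does not increase and has a
subsequence tending to `0`.

An equilibrium exists because, the graph being connected, `ker 𝐃ᵀ` consists of the consensus states
(`aggIncidence_transpose_mulVec_eq_zero_iff`). At the consensus on a minimizer of `∑ᵢ fᵢ` the
gradient of `f` is orthogonal to these, hence lies in the range of `𝐃`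
(`exists_dualDynamics_eq_zero`).

The product `Primal n N × Dual n M` carries the maximum norm, so the results are moved from the
Hilbert sum by a linear homeomorphism.
-/

namespace DualDecomposition

open Set Filter Topology Metric
open scoped RealInnerProductSpace NNReal

/-! ### Flows of monotone vector fields -/

section MonotoneFlow

variable {H : Type*} [NormedAddCommGroup H] [InnerProductSpace ℝ H]

theorem antitoneOn_norm_sub_of_inner_nonpos {D : Set ℝ} (hD : Convex ℝ D) {p q p' q' : ℝ → H}
    (hp : ∀ t ∈ D, HasDerivWithinAt p (p' t) D t) (hq : ∀ t ∈ D, HasDerivWithinAt q (q' t) D t)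
    (h : ∀ t ∈ D, ⟪p t - q t, p' t - q' t⟫ ≤ 0) : AntitoneOn (fun t => ‖p t - q t‖) D := by
  have hd : ∀ t ∈ D, HasDerivWithinAt (fun t => ‖p t - q t‖ ^ 2)
      (2 * ⟪p t - q t, p' t - q' t⟫) D t :=
    fun t ht => ((hp t ht).sub (hq t ht)).norm_sq
  have ha : AntitoneOn (fun t => ‖p t - q t‖ ^ 2) D :=
    antitoneOn_of_hasDerivWithinAt_nonpos hD (fun t ht => (hd t ht).continuousWithinAt)
      (fun t ht => (hd t (interior_subset ht)).mono interior_subset)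
      (fun t ht => by linarith [h t (interior_subset ht)])
  intro s hs t ht hst
  exact le_of_sq_le_sq (ha hs ht hst) (norm_nonneg _)

/-- The vector field `X` is monotone (in the sense of operators, with the sign for which the flow of
`X` contracts distances). -/
def IsMonotoneField (X : H → H) : Prop :=
  ∀ p q, ⟪p - q, X p - X q⟫ ≤ 0

variable {X : H → H}

theorem IsMonotoneField.antitoneOn_norm_sub (hX : IsMonotoneField X) {D : Set ℝ}
    (hD : Convex ℝ D) {p q : ℝ → H} (hp : ∀ t ∈ D, HasDerivWithinAt p (X (p t)) D t)
    (hq : ∀ t ∈ D, HasDerivWithinAt q (X (q t)) D t) :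
    AntitoneOn (fun t => ‖p t - q t‖) D :=
  antitoneOn_norm_sub_of_inner_nonpos hD hp hq fun t _ => hX (p t) (q t)

theorem isSolution_const {S : Type*} [NormedAddCommGroup S] [NormedSpace ℝ S] {X : S → S} {e : S}
    (he : X e = 0) : IsSolution X fun _ => e := fun t _ => by
  simpa [he] using hasDerivWithinAt_const t (Ici (0 : ℝ)) e

theorem IsSolution.comp_add {S : Type*} [NormedAddCommGroup S] [NormedSpace ℝ S] {X : S → S}
    {p : ℝ → S} (hp : IsSolution X p) {h : ℝ} (hh : 0 ≤ h) :
    IsSolution X fun t => p (t + h) := fun t ht => by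
  have h1 : HasDerivWithinAt (fun s : ℝ => s + h) 1 (Ici 0) t :=
    ((hasDerivAt_id t).add_const h).hasDerivWithinAt
  have h2 := (hp (t + h) (by linarith)).scomp t h1
    (fun s hs => by simp only [mem_Ici] at hs ⊢; linarith)
  simpa [Function.comp_def] using h2

theorem IsMonotoneField.eqOn_of_eq (hX : IsMonotoneField X) {T : ℝ} {p q : ℝ → H}
    (hp : ∀ t ∈ Icc 0 T, HasDerivWithinAt p (X (p t)) (Icc 0 T) t)
    (hq : ∀ t ∈ Icc 0 T, HasDerivWithinAt q (X (q t)) (Icc 0 T) t) (h0 : p 0 = q 0) :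
    EqOn p q (Icc 0 T) := fun t ht => by
  have h := hX.antitoneOn_norm_sub (convex_Icc 0 T) hp hq (left_mem_Icc.2 (ht.1.trans ht.2)) ht ht.1
  simpa [h0, sub_eq_zero] using h

/-- A solution of a monotone field exists on every interval `[0, T]`. The field is multiplied by a
cutoff function that is `1` on a ball around a zero `e` which contains the initial value; the
resulting field is bounded and globally Lipschitz. Its solutions do not move away from `e`, since
the cutoff does not change the sign of `⟪p - e, X p⟫`, so they stay where the cutoff is `1`. -/
theorem IsMonotoneField.exists_hasDerivWithinAt_Icc [FiniteDimensional ℝ H]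
    (hX : IsMonotoneField X) (hX1 : ContDiff ℝ 1 X) {e : H} (he : X e = 0) (p₀ : H)
    {T : ℝ} (hT : 0 ≤ T) :
    ∃ p : ℝ → H, p 0 = p₀ ∧ ∀ t ∈ Icc 0 T, HasDerivWithinAt p (X (p t)) (Icc 0 T) t := by
  let b : ContDiffBump e := ⟨‖p₀ - e‖ + 1, ‖p₀ - e‖ + 2, by positivity, by linarith⟩
  have hY : ContDiff ℝ 1 fun p => b p • X p := b.contDiff.smul hX1
  have hYc : HasCompactSupport fun p => b p • X p := b.hasCompactSupport.smul_right
  obtain ⟨K, hK⟩ := hY.lipschitzWith_of_hasCompactSupport hYc one_ne_zero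
  obtain ⟨L, hL⟩ := hYc.exists_bound_of_continuous hY.continuous
  have hL0 : 0 ≤ L := (norm_nonneg _).trans (hL e)
  have hPL : IsPicardLindelof (fun _ p => b p • X p) (⟨0, left_mem_Icc.2 hT⟩ : Icc 0 T) p₀
      (⟨L * T, by positivity⟩ : ℝ≥0) 0 ⟨L, hL0⟩ K :=
    { lipschitzOnWith := fun _ _ => hK.lipschitzOnWith
      continuousOn := fun _ _ => continuousOn_const
      norm_le := fun _ _ p _ => hL p
      mul_max_le := by
        change L * max (T - 0) (0 - 0) ≤ L * T - 0
        simp [hT] }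
  obtain ⟨p, hp0, hp⟩ := hPL.exists_eq_forall_mem_Icc_hasDerivWithinAt₀
  change p 0 = p₀ at hp0
  have hanti := antitoneOn_norm_sub_of_inner_nonpos (convex_Icc 0 T) hp
    (fun t _ => hasDerivWithinAt_const t (Icc 0 T) e) (fun t _ => by
      have h := hX (p t) e
      rw [he, sub_zero] at h
      rw [sub_zero, inner_smul_right]
      exact mul_nonpos_of_nonneg_of_nonpos b.nonneg h)
  refine ⟨p, hp0, fun t ht => ?_⟩
  have hle := hanti (left_mem_Icc.2 hT) ht ht.1
  simp only [hp0] at hle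
  have hb : b (p t) = 1 := b.one_of_mem_closedBall <| by
    rw [mem_closedBall, dist_eq_norm]
    change _ ≤ ‖p₀ - e‖ + 1
    linarith
  simpa [hb] using hp t ht

theorem IsMonotoneField.wellPosed [FiniteDimensional ℝ H] (hX : IsMonotoneField X)
    (hX1 : ContDiff ℝ 1 X) {e : H} (he : X e = 0) : WellPosed X := by
  intro p₀
  choose P hP0 hP using fun n : ℕ =>
    hX.exists_hasDerivWithinAt_Icc hX1 he p₀ (T := n + 1) (by positivity)
  -- Solutions on different intervals agree on the smaller one.
  have hagree : ∀ (m n : ℕ) (t : ℝ), 0 ≤ t → t ≤ m + 1 → t ≤ n + 1 → P m t = P n t := by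
    intro m n t h0 hm hn
    refine hX.eqOn_of_eq (T := min (m + 1) (n + 1)) (fun s hs => ?_) (fun s hs => ?_)
      ((hP0 m).trans (hP0 n).symm) ⟨h0, le_min hm hn⟩
    · exact (hP m s ⟨hs.1, hs.2.trans (min_le_left _ _)⟩).mono
        (Icc_subset_Icc_right (min_le_left _ _))
    · exact (hP n s ⟨hs.1, hs.2.trans (min_le_right _ _)⟩).mono
        (Icc_subset_Icc_right (min_le_right _ _))
  have hp : IsSolution X fun t => P ⌊t⌋₊ t := by
    intro t ht
    obtain ⟨m, hm⟩ : ∃ m, m = ⌊t⌋₊ := ⟨_, rfl⟩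
    have htm : t < (m : ℝ) + 1 := hm ▸ Nat.lt_floor_add_one t
    have hnhds : Icc 0 ((m : ℝ) + 1) ∈ 𝓝[Ici 0] t := by
      rw [← Ici_inter_Iic]
      exact inter_mem self_mem_nhdsWithin (mem_nhdsWithin_of_mem_nhds (Iic_mem_nhds htm))
    have h1 : HasDerivWithinAt (P m) (X (P m t)) (Ici 0) t :=
      (hP m t ⟨ht, htm.le⟩).mono_of_mem_nhdsWithin hnhds
    change HasDerivWithinAt _ (X (P ⌊t⌋₊ t)) _ _
    rw [← hm]
    refine h1.congr_of_eventuallyEq ?_ (by rw [← hm])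
    filter_upwards [hnhds] with s hs
    exact hagree _ _ s hs.1 (Nat.lt_floor_add_one s).le hs.2
  refine ⟨_, hp, by simpa using hP0 0, fun q hq hq0 t ht => ?_⟩
  have h := hX.antitoneOn_norm_sub (convex_Ici 0) hq hp self_mem_Ici ht ht
  simpa [hq0, hP0, sub_eq_zero] using h

/-- Along a solution of a monotone field the speed does not increase: the solution and its shift by
`h` do not drift apart, and the speed is the limit of their distance divided by `h`. -/
theorem IsMonotoneField.norm_velocity_le (hX : IsMonotoneField X) {p : ℝ → H}
    (hp : IsSolution X p) {t : ℝ} (ht : 0 ≤ t) : ‖X (p t)‖ ≤ ‖X (p 0)‖ := by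
  have hslope : ∀ q, IsSolution X q →
      Tendsto (fun h : ℝ => ‖h⁻¹ • (q h - q 0)‖) (𝓝[>] 0) (𝓝 ‖X (q 0)‖) := fun q hq => by
    have h := (hasDerivWithinAt_iff_tendsto_slope' self_notMem_Ioi).1 (hq 0 le_rfl).Ioi_of_Ici
    simpa [slope_fun_def] using h.norm
  have ht' := hslope _ (hp.comp_add ht)
  simp only [zero_add] at ht'
  refine le_of_tendsto_of_tendsto ht' (hslope p hp) ?_
  filter_upwards [self_mem_nhdsWithin] with h hh
  have hle := hX.antitoneOn_norm_sub (convex_Ici 0) (hp.comp_add (le_of_lt hh)) hp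
    self_mem_Ici ht ht
  simp only [zero_add] at hle
  rw [norm_smul, norm_smul, add_comm h]
  gcongr

/-- **LaSalle's invariance principle** for a monotone field. If a solution along which the squared
distance to a zero `e` has vanishing derivative can start only at a zero of the field, then every
solution converges to a zero: a limit point `a` of the solution starts a solution of constant
distance to `e`, so `a` is a zero, and the distance to the zero `a` does not increase. -/
theorem IsMonotoneField.exists_tendsto [FiniteDimensional ℝ H] (hX : IsMonotoneField X)
    (hwp : WellPosed X) {e : H} (he : X e = 0)
    (hrigid : ∀ q, IsSolution X q → (∀ t, 0 ≤ t → ⟪q t - e, X (q t)⟫ = 0) → X (q 0) = 0)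
    {p : ℝ → H} (hp : IsSolution X p) : ∃ a, X a = 0 ∧ Tendsto p atTop (𝓝 a) := by
  have hanti : ∀ a, X a = 0 → AntitoneOn (fun t => ‖p t - a‖) (Ici 0) := fun a ha =>
    hX.antitoneOn_norm_sub (convex_Ici 0) hp (isSolution_const ha)
  obtain ⟨c, hc⟩ : ∃ c, Tendsto (fun t => ‖p t - e‖) atTop (𝓝 c) := by
    have hm : Antitone fun t => ‖p (max t 0) - e‖ := fun s t hst =>
      hanti e he (le_max_right s 0) (le_max_right t 0) (max_le_max_right 0 hst)
    refine ⟨_, (tendsto_atTop_ciInf hm ⟨0, ?_⟩).congr' ?_⟩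
    · rintro _ ⟨t, rfl⟩
      positivity
    · filter_upwards [eventually_ge_atTop 0] with t ht
      rw [max_eq_left ht]
  obtain ⟨a, -, φ, hφ, ha⟩ := (isCompact_closedBall e ‖p 0 - e‖).tendsto_subseq
    (x := fun k : ℕ => p k) fun k => by
      rw [mem_closedBall, dist_eq_norm]
      exact hanti e he self_mem_Ici (mem_Ici.2 k.cast_nonneg) k.cast_nonneg
  have hφ' : Tendsto (fun k => (φ k : ℝ)) atTop atTop :=
    tendsto_natCast_atTop_atTop.comp hφ.tendsto_atTop
  have ha0 : Tendsto (fun k => ‖p (φ k) - a‖) atTop (𝓝 0) := tendsto_iff_norm_sub_tendsto_zero.1 ha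
  obtain ⟨q, hq, hq0, -⟩ := hwp a
  have hqc : ∀ t, 0 ≤ t → ‖q t - e‖ = c := fun t ht => by
    have h1 : Tendsto (fun k => p (t + φ k)) atTop (𝓝 (q t)) := by
      rw [tendsto_iff_norm_sub_tendsto_zero]
      refine squeeze_zero (fun _ => norm_nonneg _) (fun k => ?_) ha0
      have h := hX.antitoneOn_norm_sub (convex_Ici 0)
        (hp.comp_add (h := φ k) (Nat.cast_nonneg _)) hq self_mem_Ici ht ht
      simpa [hq0] using h
    exact tendsto_nhds_unique (h1.sub_const e).norm
      (hc.comp (tendsto_atTop_add_const_left _ t hφ'))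
  have hXa : X a = 0 := by
    rw [← hq0]
    refine hrigid q hq fun t ht => ?_
    have h1 : HasDerivWithinAt (fun t => ‖q t - e‖ ^ 2) (2 * ⟪q t - e, X (q t)⟫) (Ici 0) t :=
      ((hq t ht).sub_const e).norm_sq
    have h2 : HasDerivWithinAt (fun t => ‖q t - e‖ ^ 2) 0 (Ici 0) t :=
      (hasDerivWithinAt_const t (Ici 0) (c ^ 2)).congr (fun s hs => by rw [hqc s hs])
        (by rw [hqc t ht])
    linarith [(uniqueDiffOn_Ici (0 : ℝ) t ht).eq_deriv _ h1 h2]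
  refine ⟨a, hXa, tendsto_iff_norm_sub_tendsto_zero.2 (Metric.tendsto_atTop.2 fun ε hε => ?_)⟩
  obtain ⟨k, hk⟩ := (ha0.eventually_lt_const hε).exists
  refine ⟨φ k, fun t ht => ?_⟩
  rw [Real.dist_eq, sub_zero, abs_norm]
  exact (hanti a hXa (mem_Ici.2 (Nat.cast_nonneg _)) (mem_Ici.2 ((Nat.cast_nonneg _).trans ht))
    ht).trans_lt hk

theorem IsMonotoneField.velocityGAS (hX : IsMonotoneField X) (hXc : Continuous X)
    (hconv : ∀ p, IsSolution X p → ∃ a, X a = 0 ∧ Tendsto p atTop (𝓝 a)) : VelocityGAS X := by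
  refine ⟨fun ε hε => ⟨ε, hε, fun p hp h t ht => (hX.norm_velocity_le hp ht).trans_lt h⟩,
    fun p hp => ?_⟩
  obtain ⟨a, ha, hpa⟩ := hconv p hp
  exact ha ▸ (hXc.tendsto a).comp hpa

theorem IsMonotoneField.equilibriaGAS (hX : IsMonotoneField X)
    (hconv : ∀ p, IsSolution X p → ∃ a, X a = 0 ∧ Tendsto p atTop (𝓝 a)) : EquilibriaGAS X :=
  ⟨fun _ he ε hε => ⟨ε, hε, fun _ hp h _ ht =>
    (hX.antitoneOn_norm_sub (convex_Ici 0) hp (isSolution_const he) self_mem_Ici ht ht).trans_lt h⟩,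
    hconv⟩

end MonotoneFlow

/-! ### Transport along a linear equivalence -/

section Conjugation

variable {S H : Type*} [NormedAddCommGroup S] [NormedSpace ℝ S] [NormedAddCommGroup H]
  [NormedSpace ℝ H] {X : S → S} {Y : H → H}

theorem IsSolution.map (Φ : S ≃L[ℝ] H) (hΦ : ∀ p, Y (Φ p) = Φ (X p)) {p : ℝ → S}
    (hp : IsSolution X p) : IsSolution Y fun t => Φ (p t) := fun t ht => by
  simpa [hΦ, Function.comp_def] using
    Φ.hasFDerivAt.comp_hasDerivWithinAt (f := p) t (hp t ht)

theorem apply_symm_of_conj (Φ : S ≃L[ℝ] H) (hΦ : ∀ p, Y (Φ p) = Φ (X p)) (p : H) :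
    X (Φ.symm p) = Φ.symm (Y p) := by
  rw [Φ.eq_symm_apply, ← hΦ, Φ.apply_symm_apply]

theorem WellPosed.of_conj (Φ : S ≃L[ℝ] H) (hΦ : ∀ p, Y (Φ p) = Φ (X p)) (hY : WellPosed Y) :
    WellPosed X := by
  intro p₀
  obtain ⟨p, hp, hp0, huniq⟩ := hY (Φ p₀)
  refine ⟨_, hp.map Φ.symm (apply_symm_of_conj Φ hΦ), by simp [hp0], fun q hq hq0 t ht => ?_⟩
  simp [← huniq _ (hq.map Φ hΦ) (by simp [hq0]) ht]

theorem exists_norm_bounds (Φ : S ≃L[ℝ] H) :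
    ∃ C > 0, (∀ p, ‖Φ p‖ ≤ C * ‖p‖) ∧ ∀ p, ‖p‖ ≤ C * ‖Φ p‖ := by
  obtain ⟨A, hA, hAb⟩ := (Φ : S →L[ℝ] H).bound
  obtain ⟨B, hB, hBb⟩ := (Φ.symm : H →L[ℝ] S).bound
  refine ⟨max A B, lt_max_of_lt_left hA, fun p => (hAb p).trans ?_, fun p => ?_⟩
  · gcongr
    exact le_max_left _ _
  · have h := hBb (Φ p)
    simp only [ContinuousLinearEquiv.coe_coe, ContinuousLinearEquiv.symm_apply_apply] at h
    refine h.trans ?_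
    gcongr
    exact le_max_right _ _

theorem VelocityGAS.of_conj (Φ : S ≃L[ℝ] H) (hΦ : ∀ p, Y (Φ p) = Φ (X p)) (hY : VelocityGAS Y) :
    VelocityGAS X := by
  obtain ⟨C, hC, hΦC, hCΦ⟩ := exists_norm_bounds Φ
  refine ⟨fun ε hε => ?_, fun p hp => ?_⟩
  · obtain ⟨δ, hδ, h⟩ := hY.1 (ε / C) (by positivity)
    refine ⟨δ / C, by positivity, fun p hp hp0 t ht => (hCΦ _).trans_lt ?_⟩
    rw [← lt_div_iff₀' hC, ← hΦ]
    refine h _ (hp.map Φ hΦ) ?_ t ht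
    rw [hΦ]
    exact (hΦC _).trans_lt ((lt_div_iff₀' hC).1 hp0)
  · have h := (Φ.symm.continuous.tendsto 0).comp (hY.2 _ (hp.map Φ hΦ))
    simpa [Function.comp_def, hΦ] using h

theorem EquilibriaGAS.of_conj (Φ : S ≃L[ℝ] H) (hΦ : ∀ p, Y (Φ p) = Φ (X p))
    (hY : EquilibriaGAS Y) : EquilibriaGAS X := by
  obtain ⟨C, hC, hΦC, hCΦ⟩ := exists_norm_bounds Φ
  refine ⟨fun e he ε hε => ?_, fun p hp => ?_⟩
  · obtain ⟨δ, hδ, h⟩ := hY.1 (Φ e) (by rw [hΦ, he, map_zero]) (ε / C) (by positivity)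
    refine ⟨δ / C, by positivity, fun p hp hp0 t ht => (hCΦ _).trans_lt ?_⟩
    rw [← lt_div_iff₀' hC, map_sub]
    refine h _ (hp.map Φ hΦ) ?_ t ht
    rw [← map_sub]
    exact (hΦC _).trans_lt ((lt_div_iff₀' hC).1 hp0)
  · obtain ⟨a, ha, hpa⟩ := hY.2 _ (hp.map Φ hΦ)
    refine ⟨Φ.symm a, by rw [apply_symm_of_conj Φ hΦ, ha, map_zero], ?_⟩
    simpa [Function.comp_def] using (Φ.symm.continuous.tendsto a).comp hpa

end Conjugation

/-! ### Gradients of strictly convex functions -/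

section Gradient

variable {E : Type*} [NormedAddCommGroup E] [InnerProductSpace ℝ E] [CompleteSpace E] {φ : E → ℝ}

theorem hasDerivAt_comp_lineMap (hφ : Differentiable ℝ φ) (x y : E) (t : ℝ) :
    HasDerivAt (fun t : ℝ => φ (AffineMap.lineMap x y t))
      ⟪∇ φ (AffineMap.lineMap x y t), y - x⟫ t := by
  have h := (hφ (AffineMap.lineMap x y t)).hasGradientAt.hasFDerivAt.comp_hasDerivAt t
    (AffineMap.hasDerivAt_lineMap (a := x) (b := y))
  exact h

/-- The first-order condition for strict convexity. -/
theorem add_inner_gradient_lt (hφ : Differentiable ℝ φ) (hc : StrictConvexOn ℝ univ φ) {x y : E}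
    (hxy : x ≠ y) : φ x + ⟪∇ φ x, y - x⟫ < φ y := by
  have hg : StrictConvexOn ℝ univ fun t : ℝ => φ (AffineMap.lineMap x y t) := by
    refine ⟨convex_univ, fun s _ t _ hst a b ha hb hab => ?_⟩
    have h := hc.2 (mem_univ (AffineMap.lineMap x y s)) (mem_univ (AffineMap.lineMap x y t))
      ((AffineMap.lineMap_injective ℝ hxy).ne hst) ha hb hab
    rwa [← Convex.combo_affine_apply hab] at h
  have h := hg.lt_slope_of_hasDerivAt (mem_univ 0) (mem_univ 1) one_pos
    (hasDerivAt_comp_lineMap hφ x y 0)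
  simp only [slope_def_field, AffineMap.lineMap_apply_zero, AffineMap.lineMap_apply_one, sub_zero,
    div_one] at h
  linarith

theorem add_inner_gradient_le (hφ : Differentiable ℝ φ) (hc : StrictConvexOn ℝ univ φ) (x y : E) :
    φ x + ⟪∇ φ x, y - x⟫ ≤ φ y := by
  rcases eq_or_ne x y with rfl | hxy
  · simp
  · exact (add_inner_gradient_lt hφ hc hxy).le

theorem inner_sub_gradient_sub_pos (hφ : Differentiable ℝ φ) (hc : StrictConvexOn ℝ univ φ)
    {x y : E} (hxy : x ≠ y) : 0 < ⟪x - y, ∇ φ x - ∇ φ y⟫ := by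
  have h1 := add_inner_gradient_lt hφ hc hxy
  have h2 := add_inner_gradient_lt hφ hc hxy.symm
  rw [← neg_sub x y, inner_neg_right] at h1
  rw [inner_sub_right, real_inner_comm, real_inner_comm (∇ φ y)]
  linarith

theorem contDiff_gradient (hφ : ContDiff ℝ 2 φ) : ContDiff ℝ 1 (∇ φ) :=
  (InnerProductSpace.toDual ℝ E).symm.contDiff.comp (hφ.fderiv_right (m := 1) (by norm_num))

theorem gradient_const_mul (c : ℝ) (hφ : Differentiable ℝ φ) (x : E) :
    ∇ (fun y => c * φ y) x = c • ∇ φ x := by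
  refine HasGradientAt.gradient ?_
  rw [hasGradientAt_iff_hasFDerivAt, map_smul]
  exact (hφ x).hasGradientAt.hasFDerivAt.const_mul c

theorem gradient_eq_zero_of_forall_le {x : E} (h : ∀ y, φ x ≤ φ y) : ∇ φ x = 0 := by
  have h0 : IsLocalMin φ x := Eventually.of_forall h
  simp [gradient, h0.fderiv_eq_zero]

end Gradient

/-! ### Saddle flows -/

section SaddleFlow

variable {E F : Type*} [NormedAddCommGroup E] [InnerProductSpace ℝ E] [CompleteSpace E]
  [NormedAddCommGroup F] [InnerProductSpace ℝ F] [CompleteSpace F] {φ : E → ℝ} {A : F →L[ℝ] E}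

open ContinuousLinearMap (adjoint)

/-- The saddle flow of `(z, μ) ↦ φ z + ⟪z, A μ⟫`: gradient descent in `z` and gradient ascent
in `μ`. -/
noncomputable def saddleFlow (φ : E → ℝ) (A : F →L[ℝ] E) (p : E × F) : E × F :=
  (-∇ φ p.1 - A p.2, adjoint A p.1)

theorem saddleFlow_eq_zero_iff {p : E × F} :
    saddleFlow φ A p = 0 ↔ ∇ φ p.1 + A p.2 = 0 ∧ adjoint A p.1 = 0 := by
  rw [saddleFlow, Prod.mk_eq_zero, ← neg_add', neg_eq_zero]

theorem saddleFlow_eq_zero_iff_isSaddlePoint (hφ : Differentiable ℝ φ)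
    (hc : StrictConvexOn ℝ univ φ) (p : E × F) :
    saddleFlow φ A p = 0 ↔ IsSaddlePoint (fun z μ => φ z + ⟪z, A μ⟫) p := by
  rw [saddleFlow_eq_zero_iff]
  constructor
  · rintro ⟨h1, h2⟩
    refine ⟨fun μ => ?_, fun z => ?_⟩
    · simp [← ContinuousLinearMap.adjoint_inner_left, h2]
    · have h := add_inner_gradient_le hφ hc p.1 z
      rw [eq_neg_of_add_eq_zero_left h1, inner_neg_left, inner_sub_right, real_inner_comm,
        real_inner_comm p.1] at h
      linarith
  · rintro ⟨h1, h2⟩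
    constructor
    · have hd : HasGradientAt (fun z => φ z + ⟪z, A p.2⟫) (∇ φ p.1 + A p.2) p.1 := by
        rw [hasGradientAt_iff_hasFDerivAt, map_add]
        refine (hφ p.1).hasGradientAt.hasFDerivAt.add ?_
        refine (innerSL ℝ (A p.2)).hasFDerivAt.congr_of_eventuallyEq ?_
        exact Eventually.of_forall fun z => real_inner_comm _ _
      rw [← hd.gradient]
      exact gradient_eq_zero_of_forall_le h2
    · -- Moving `μ` in the direction of `A† z` would raise the value.
      have h := h1 (p.2 + adjoint A p.1)
      simp only [map_add, inner_add_right] at h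
      rw [← ContinuousLinearMap.adjoint_inner_left A (adjoint A p.1)] at h
      exact inner_self_eq_zero.1 (le_antisymm (by linarith) real_inner_self_nonneg)

/-- The saddle flow on the Hilbert sum of the two spaces. -/
noncomputable def hilbertSaddleFlow (φ : E → ℝ) (A : F →L[ℝ] E) (p : WithLp 2 (E × F)) :
    WithLp 2 (E × F) :=
  WithLp.toLp 2 (saddleFlow φ A p.ofLp)

/-- The coupling terms `-A μ` and `A† z` of the saddle flow are skew-adjoint, so they drop out. -/
theorem inner_sub_hilbertSaddleFlow_sub (p q : WithLp 2 (E × F)) :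
    ⟪p - q, hilbertSaddleFlow φ A p - hilbertSaddleFlow φ A q⟫ =
      -⟪p.fst - q.fst, ∇ φ p.fst - ∇ φ q.fst⟫ := by
  rw [WithLp.prod_inner_apply]
  change ⟪p.fst - q.fst, (-∇ φ p.fst - A p.snd) - (-∇ φ q.fst - A q.snd)⟫ +
    ⟪p.snd - q.snd, adjoint A p.fst - adjoint A q.fst⟫ = _
  rw [← map_sub (adjoint A), ContinuousLinearMap.adjoint_inner_right, real_inner_comm, map_sub]
  simp only [inner_sub_left, inner_sub_right, inner_neg_left]
  simp only [real_inner_comm]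
  ring

theorem isMonotoneField_hilbertSaddleFlow (hφ : Differentiable ℝ φ)
    (hc : StrictConvexOn ℝ univ φ) : IsMonotoneField (hilbertSaddleFlow φ A) := by
  intro p q
  rw [inner_sub_hilbertSaddleFlow_sub, neg_nonpos]
  rcases eq_or_ne p.fst q.fst with h | h
  · simp [h]
  · exact (inner_sub_gradient_sub_pos hφ hc h).le

theorem contDiff_saddleFlow (hφ : ContDiff ℝ 2 φ) : ContDiff ℝ 1 (saddleFlow φ A) :=
  ((((contDiff_gradient hφ).comp contDiff_fst).neg).sub (A.contDiff.comp contDiff_snd)).prodMk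
    ((adjoint A).contDiff.comp contDiff_fst)

theorem contDiff_hilbertSaddleFlow (hφ : ContDiff ℝ 2 φ) : ContDiff ℝ 1 (hilbertSaddleFlow φ A) :=
  (WithLp.prodContinuousLinearEquiv 2 ℝ E F).symm.contDiff.comp
    ((contDiff_saddleFlow hφ).comp (WithLp.prodContinuousLinearEquiv 2 ℝ E F).contDiff)

/-- A trajectory along which the squared distance to an equilibrium `e` has vanishing derivative has
the constant primal part `e.fst`, by strict convexity. Hence `ż = 0` along it, and also
`μ̇ = A† e.fst = 0`. -/
theorem hilbertSaddleFlow_eq_zero_of_inner_eq_zero (hφ : Differentiable ℝ φ)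
    (hc : StrictConvexOn ℝ univ φ) {e : WithLp 2 (E × F)} (he : hilbertSaddleFlow φ A e = 0)
    {q : ℝ → WithLp 2 (E × F)} (hq : IsSolution (hilbertSaddleFlow φ A) q)
    (h : ∀ t, 0 ≤ t → ⟪q t - e, hilbertSaddleFlow φ A (q t)⟫ = 0) :
    hilbertSaddleFlow φ A (q 0) = 0 := by
  have hfst : ∀ t, 0 ≤ t → (q t).fst = e.fst := fun t ht => by
    by_contra hne
    have h1 := inner_sub_hilbertSaddleFlow_sub (φ := φ) (A := A) (q t) e
    rw [he, sub_zero, h t ht] at h1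
    linarith [inner_sub_gradient_sub_pos hφ hc hne]
  have he' : saddleFlow φ A e.ofLp = 0 := congrArg WithLp.ofLp he
  have hd : HasDerivWithinAt (fun t => (q t).fst) (hilbertSaddleFlow φ A (q 0)).fst (Ici 0) 0 :=
    (WithLp.fstL 2 ℝ E F).hasFDerivAt.comp_hasDerivWithinAt 0 (hq 0 le_rfl)
  have hd' : HasDerivWithinAt (fun t => (q t).fst) 0 (Ici 0) 0 :=
    (hasDerivWithinAt_const 0 (Ici 0) e.fst).congr (fun t ht => hfst t ht) (hfst 0 le_rfl)
  have h1 : (hilbertSaddleFlow φ A (q 0)).fst = 0 :=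
    (uniqueDiffOn_Ici (0 : ℝ) 0 self_mem_Ici).eq_deriv _ hd hd'
  have h2 : (hilbertSaddleFlow φ A (q 0)).snd = 0 := by
    change adjoint A (q 0).fst = 0
    rw [hfst 0 le_rfl]
    exact (saddleFlow_eq_zero_iff.1 he').2
  exact congrArg (WithLp.toLp 2) (Prod.ext h1 h2 : (hilbertSaddleFlow φ A (q 0)).ofLp = 0)

theorem saddleFlow_stable [FiniteDimensional ℝ E] [FiniteDimensional ℝ F] (hφ : ContDiff ℝ 2 φ)
    (hc : StrictConvexOn ℝ univ φ) (he : ∃ e, saddleFlow φ A e = 0) :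
    WellPosed (saddleFlow φ A) ∧ VelocityGAS (saddleFlow φ A) ∧ EquilibriaGAS (saddleFlow φ A) := by
  obtain ⟨e, he⟩ := he
  have hφ' : Differentiable ℝ φ := hφ.differentiable (by norm_num)
  have he' : hilbertSaddleFlow φ A (WithLp.toLp 2 e) = 0 := congrArg (WithLp.toLp 2) he
  have hX := isMonotoneField_hilbertSaddleFlow (A := A) hφ' hc
  have hX1 := contDiff_hilbertSaddleFlow (A := A) hφ
  have hwp := hX.wellPosed hX1 he'
  have hconv := fun p => hX.exists_tendsto hwp he' (p := p) fun q =>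
    hilbertSaddleFlow_eq_zero_of_inner_eq_zero hφ' hc he'
  let Φ := (WithLp.prodContinuousLinearEquiv 2 ℝ E F).symm
  have hΦ : ∀ p, hilbertSaddleFlow φ A (Φ p) = Φ (saddleFlow φ A p) := fun _ => rfl
  exact ⟨hwp.of_conj Φ hΦ, (hX.velocityGAS hX1.continuous hconv).of_conj Φ hΦ,
    (hX.equilibriaGAS hconv).of_conj Φ hΦ⟩

/-- An equilibrium of the saddle flow exists above a point `z` of `ker A†` at which `∇ φ` is
orthogonal to `ker A†`: the multiplier is a preimage of `-∇ φ z`, as `ker A†` is the orthogonal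
complement of `range A`. -/
theorem exists_saddleFlow_eq_zero [FiniteDimensional ℝ F] {z : E} (hz : adjoint A z = 0)
    (h : ∀ w, adjoint A w = 0 → ⟪∇ φ z, w⟫ = 0) : ∃ p, saddleFlow φ A p = 0 := by
  have hmem : ∇ φ z ∈ A.rangeᗮᗮ := by
    rw [A.orthogonal_range, Submodule.mem_orthogonal']
    exact fun w hw => h w hw
  rw [Submodule.orthogonal_orthogonal] at hmem
  obtain ⟨μ, hμ⟩ := hmem
  refine ⟨(z, -μ), saddleFlow_eq_zero_iff.2 ⟨?_, hz⟩⟩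
  change A μ = _ at hμ
  simp [hμ]

end SaddleFlow

/-! ### The network: aggregate cost and incidence matrix -/

section Network

variable {n N M : ℕ}

theorem agent_combo (a b : ℝ) (z w : Primal n N) (i : Fin N) :
    agent (a • z + b • w) i = a • agent z i + b • agent w i := by
  ext j
  simp [agent]

theorem contDiff_agent (i : Fin N) : ContDiff ℝ 2 fun z : Primal n N => agent z i := by
  rw [contDiff_euclidean]
  intro j
  change ContDiff ℝ 2 fun z : Primal n N => z (j, i)
  fun_prop

theorem contDiff_aggCost {f : Fin N → EuclideanSpace ℝ (Fin n) → ℝ}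
    (hf : ∀ i, ContDiff ℝ 2 (f i)) : ContDiff ℝ 2 (aggCost f) :=
  ContDiff.sum fun i _ => (hf i).comp (contDiff_agent i)

theorem strictConvexOn_aggCost {f : Fin N → EuclideanSpace ℝ (Fin n) → ℝ}
    (hf : ∀ i, StrictConvexOn ℝ univ (f i)) : StrictConvexOn ℝ univ (aggCost f) := by
  refine ⟨convex_univ, fun z _ w _ hzw a b ha hb hab => ?_⟩
  obtain ⟨i, hi⟩ : ∃ i, agent z i ≠ agent w i := by
    by_contra! h
    refine hzw (PiLp.ext fun ⟨j, i⟩ => ?_)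
    exact congrArg (fun x : EuclideanSpace ℝ (Fin n) => x j) (h i)
  simp only [aggCost, agent_combo, smul_eq_mul, Finset.mul_sum]
  rw [← Finset.sum_add_distrib]
  exact Finset.sum_lt_sum (fun i _ => (hf i).convexOn.2 (mem_univ _) (mem_univ _) ha.le hb.le hab)
    ⟨i, Finset.mem_univ i, (hf i).2 (mem_univ _) (mem_univ _) hi ha hb hab⟩

/-- The aggregate state in which every agent maintains the vector `x`. -/
def consensus (N : ℕ) (x : EuclideanSpace ℝ (Fin n)) : Primal n N :=
  WithLp.toLp 2 fun k => x k.1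

theorem agent_consensus (x : EuclideanSpace ℝ (Fin n)) (i : Fin N) :
    agent (consensus N x) i = x := rfl

/-- At the consensus on a minimizer of `∑ᵢ fᵢ`, the gradient of the aggregate cost is orthogonal to
all consensus states, though it need not vanish. -/
theorem inner_gradient_aggCost_consensus {f : Fin N → EuclideanSpace ℝ (Fin n) → ℝ}
    (hf : Differentiable ℝ (aggCost f)) {x : EuclideanSpace ℝ (Fin n)}
    (hx : ∀ y, ∑ i, f i x ≤ ∑ i, f i y) (y : EuclideanSpace ℝ (Fin n)) :
    ⟪∇ (aggCost f) (consensus N x), consensus N y⟫ = 0 := by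
  have hd := hasDerivAt_comp_lineMap hf (consensus N x) (consensus N x + consensus N y) 0
  rw [AffineMap.lineMap_apply_zero, add_sub_cancel_left] at hd
  refine IsLocalMin.hasDerivAt_eq_zero (Eventually.of_forall fun t => ?_) hd
  have hline : (AffineMap.lineMap (consensus N x) (consensus N x + consensus N y) t : Primal n N) =
      consensus N (x + t • y) := by
    ext k
    simp [AffineMap.lineMap_apply, consensus, add_comm]
  rw [hline, AffineMap.lineMap_apply_zero]
  simpa only [aggCost, agent_consensus] using hx (x + t • y)

variable {G : SimpleGraph (Fin N)} (o : OrientedEdges G M)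

theorem OrientedEdges.adj (k : Fin M) : G.Adj (o.tail k) (o.head k) := by
  rw [← SimpleGraph.mem_edgeSet, ← o.range_eq]
  exact mem_range_self k

theorem aggIncidence_transpose_mulVec (v : Fin n × Fin N → ℝ) (j : Fin n) (k : Fin M) :
    ((aggIncidence n o)ᵀ *ᵥ v) (j, k) = v (j, o.head k) - v (j, o.tail k) := by
  have hne : o.head k ≠ o.tail k := (o.adj k).ne'
  have hcoef : ∀ i, incidence o i k =
      (if o.head k = i then (1 : ℝ) else 0) - if o.tail k = i then 1 else 0 := fun i => by
    rcases eq_or_ne (o.head k) i with rfl | h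
    · simp [incidence, hne.symm]
    · simp [incidence, h, neg_ite]
  simp [Matrix.mulVec, dotProduct, aggIncidence, Fintype.sum_prod_type, Matrix.one_apply, hcoef,
    sub_mul, Finset.sum_sub_distrib]

/-- On a connected graph the kernel of `𝐃ᵀ` consists of the consensus states. -/
theorem aggIncidence_transpose_mulVec_eq_zero_iff (hG : G.Connected) (z : Primal n N) :
    (aggIncidence n o)ᵀ *ᵥ z.ofLp = 0 ↔ ∃ x, z = consensus N x := by
  constructor
  · intro h
    have hadj : ∀ j i i', G.Adj i i' → z (j, i) = z (j, i') := fun j i i' hii' => by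
      rw [← SimpleGraph.mem_edgeSet, ← o.range_eq] at hii'
      obtain ⟨k, hk⟩ := hii'
      have hjk := congrFun h (j, k)
      rw [aggIncidence_transpose_mulVec, Pi.zero_apply, sub_eq_zero] at hjk
      rcases Sym2.eq_iff.1 hk with ⟨rfl, rfl⟩ | ⟨rfl, rfl⟩
      exacts [hjk.symm, hjk]
    have hwalk : ∀ j i i', G.Walk i i' → z (j, i) = z (j, i') := fun j i i' w => by
      induction w with
      | nil => rfl
      | cons h _ ih => exact (hadj j _ _ h).trans ih
    obtain ⟨i₀⟩ := hG.nonempty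
    refine ⟨agent z i₀, PiLp.ext fun ⟨j, i⟩ => ?_⟩
    obtain ⟨w⟩ := hG.preconnected i i₀
    exact hwalk j i i₀ w
  · rintro ⟨x, rfl⟩
    ext ⟨j, k⟩
    simp [aggIncidence_transpose_mulVec, consensus]

/-- The coupling `k_I' 𝐃` as an operator between Euclidean spaces. -/
noncomputable def coupling (n : ℕ) {N M : ℕ} {G : SimpleGraph (Fin N)} (o : OrientedEdges G M)
    (kI : ℝ) : Dual n M →L[ℝ] Primal n N :=
  kI • (Matrix.toEuclideanLin (aggIncidence n o)).toContinuousLinearMap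

theorem coupling_apply (kI : ℝ) (μ : Dual n M) :
    coupling n o kI μ = kI • WithLp.toLp 2 (aggIncidence n o *ᵥ μ.ofLp) := rfl

theorem adjoint_coupling_apply (kI : ℝ) (z : Primal n N) :
    ContinuousLinearMap.adjoint (coupling n o kI) z =
      kI • WithLp.toLp 2 ((aggIncidence n o)ᵀ *ᵥ z.ofLp) := by
  refine ext_inner_right ℝ fun μ => ?_
  rw [ContinuousLinearMap.adjoint_inner_left, coupling_apply, inner_smul_left, inner_smul_right,
    EuclideanSpace.inner_eq_star_dotProduct, EuclideanSpace.inner_eq_star_dotProduct]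
  simp [Matrix.mulVec_transpose, Matrix.dotProduct_mulVec, dotProduct_comm]

theorem dualDynamics_eq_saddleFlow {f : Fin N → EuclideanSpace ℝ (Fin n) → ℝ}
    (hf : Differentiable ℝ (aggCost f)) (kG kI : ℝ) :
    dualDynamics o f kG kI = saddleFlow (fun z => kG * aggCost f z) (coupling n o kI) := by
  ext1 p
  rw [saddleFlow, gradient_const_mul kG hf, coupling_apply, adjoint_coupling_apply, dualDynamics]

theorem lagrangian_eq (f : Fin N → EuclideanSpace ℝ (Fin n) → ℝ) (kG kI : ℝ) :
    lagrangian o f kG kI = fun z μ => kG * aggCost f z + ⟪z, coupling n o kI μ⟫ := by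
  ext z μ
  rw [lagrangian, coupling_apply, inner_smul_right, EuclideanSpace.inner_eq_star_dotProduct,
    star_trivial, dotProduct_comm]

theorem exists_dualDynamics_eq_zero {f : Fin N → EuclideanSpace ℝ (Fin n) → ℝ}
    (hf : Differentiable ℝ (aggCost f)) (hmin : ∃ x, ∀ y, ∑ i, f i x ≤ ∑ i, f i y)
    (hG : G.Connected) (kG : ℝ) {kI : ℝ} (hkI : kI ≠ 0) : ∃ p, dualDynamics o f kG kI p = 0 := by
  obtain ⟨x, hx⟩ := hmin
  have hker : ∀ w, ContinuousLinearMap.adjoint (coupling n o kI) w = 0 ↔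
      ∃ y, w = consensus N y := fun w => by
    rw [← aggIncidence_transpose_mulVec_eq_zero_iff o hG, adjoint_coupling_apply,
      smul_eq_zero_iff_right hkI, WithLp.toLp_eq_zero]
  rw [dualDynamics_eq_saddleFlow o hf]
  refine exists_saddleFlow_eq_zero ((hker _).2 ⟨x, rfl⟩) fun w hw => ?_
  obtain ⟨y, rfl⟩ := (hker w).1 hw
  rw [gradient_const_mul kG hf, inner_smul_left, inner_gradient_aggCost_consensus hf hx, mul_zero]

end Network

end DualDecomposition

theorem mainTheorem3 {n N M : ℕ}
    -- the individual costs: twice continuously differentiable and strictly convex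
    (f : Fin N → EuclideanSpace ℝ (Fin n) → ℝ)
    (hf_smooth : ∀ i, ContDiff ℝ 2 (f i))
    (hf_convex : ∀ i, StrictConvexOn ℝ Set.univ (f i))
    -- the total cost attains its minimum
    (hf_min : ∃ xstar, ∀ x, ∑ i, f i xstar ≤ ∑ i, f i x)
    -- the connected communication graph, with its `M` edges oriented arbitrarily
    (G : SimpleGraph (Fin N)) (hG : G.Connected)
    (o : DualDecomposition.OrientedEdges G M)
    -- the gains
    (kG kI : ℝ) (hkG : 0 < kG) (hkI : 0 < kI) :
    (∃ p, DualDecomposition.dualDynamics o f kG kI p = 0) ∧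
    (∀ p, DualDecomposition.dualDynamics o f kG kI p = 0 ↔
      DualDecomposition.IsSaddlePoint (DualDecomposition.lagrangian o f kG kI) p) ∧
    DualDecomposition.WellPosed (DualDecomposition.dualDynamics o f kG kI) ∧
    DualDecomposition.VelocityGAS (DualDecomposition.dualDynamics o f kG kI) ∧
    DualDecomposition.EquilibriaGAS (DualDecomposition.dualDynamics o f kG kI) := by
  have hC2 := DualDecomposition.contDiff_aggCost hf_smooth
  have hd : Differentiable ℝ (DualDecomposition.aggCost f) := hC2.differentiable (by norm_num)
  have hC2' : ContDiff ℝ 2 fun z => kG * DualDecomposition.aggCost f z := contDiff_const.mul hC2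
  have hconv : StrictConvexOn ℝ Set.univ fun z => kG * DualDecomposition.aggCost f z := by
    refine ⟨convex_univ, fun z hz w hw hzw a b ha hb hab => ?_⟩
    have h := (DualDecomposition.strictConvexOn_aggCost hf_convex).2 hz hw hzw ha hb hab
    simp only [smul_eq_mul] at h ⊢
    nlinarith
  have heq := DualDecomposition.exists_dualDynamics_eq_zero o hd hf_min hG kG hkI.ne'
  refine ⟨heq, ?_⟩
  rw [DualDecomposition.dualDynamics_eq_saddleFlow o hd, DualDecomposition.lagrangian_eq] at *
  exact ⟨DualDecomposition.saddleFlow_eq_zero_iff_isSaddlePoint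
    (hC2'.differentiable (by norm_num)) hconv, DualDecomposition.saddleFlow_stable hC2' hconv heq⟩
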